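/- Let $\lambda$ be a regular cardinal and let $\mathcal A$ be a (locally small, possibly large) category which is $\lambda$-cocomplete, i.e. $\mathcal A$ has colimits of all diagrams $D:\mathcal D\to\mathcal A$ for which $\mathcal D$ has fewer than $\lambda$ morphisms. A presheaf $\mathcal A^{op}\to\mathbf{Set}$ is called small if it is a colimit of a small diagram of hom-functors; let $\mathcal P(\mathcal A)$ be the category of small presheaves and all natural transformations, and let $\mathrm{Ind}_\lambda(\mathcal A)$ be its full subcategory consisting of the colimits of small $\lambda$-filtered diagrams of hom-functors. Call $\mathcal A$ approximately complete if, for every small diagram $D:\mathcal D\to\mathcal A$, there is a (small) set $\mathcal X$ of cones over $D$ such that every cone $K\to D$ factors through some cone $X\to D$ in $\mathcal X$, i.e. there is a morphism $K\to X$ in $\mathcal A$ compatible with the projections to $D$ (the category of cones over $D$, with its usual morphisms, has a weakly terminal set). Then $\mathrm{Ind}_\lambda(\mathcal A)$ is complete (has all small limits) if and only if $\mathcal A$ is approximately complete. -/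

import Mathlib

open CategoryTheory CategoryTheory.Limits Opposite

universe w v u

namespace ClassAccessible

/-- A category `C` has a weakly terminal set of objects: there is a (`w`-small) set `S` of
objects such that every object of `C` admits a morphism into some member of `S`. -/
def HasWeaklyTerminalSet (C : Type u) [Category.{v} C] : Prop :=
  ∃ S : Set C, Small.{w} S ∧ ∀ X : C, ∃ T ∈ S, Nonempty (X ⟶ T)

/-- A category `A` is approximately complete if for each small diagram `D` in `A` there is a small
set of cones over `D` such that every cone over `D` factors through a member of the set.
(A morphism `c ⟶ d` in `Cone D` is a morphism `c.pt ⟶ d.pt` which is compatible with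
the projections.) -/
def ApproximatelyComplete (A : Type u) [Category.{v} A] : Prop :=
  ∀ (J : Type w) [SmallCategory J] (D : J ⥤ A), HasWeaklyTerminalSet.{w} (Cone D)

/-- A category is `κ`-cocomplete if it has colimits of all diagrams indexed by categories with
less than `κ` morphisms. -/
def CardinalCocomplete (A : Type u) [Category.{v} A] (κ : Cardinal.{w}) : Prop :=
  ∀ (J : Type w) [SmallCategory J], HasCardinalLT (Arrow J) κ → HasColimitsOfShape J A

/-- A presheaf of sets is small if it is a colimit of a small diagram of hom-functors. -/
def isSmallPresheaf (A : Type u) [Category.{w} A] : ObjectProperty (Aᵒᵖ ⥤ Type w) :=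
  fun P => ∃ (J : Type w) (_ : SmallCategory J) (F : J ⥤ A)
    (ι : F ⋙ yoneda ⟶ (Functor.const J).obj P), Nonempty (IsColimit (Cocone.mk P ι))

/-- The category of small presheaves on `A`, a full subcategory of all presheaves. -/
abbrev SmallPresheaf (A : Type u) [Category.{w} A] := (isSmallPresheaf A).FullSubcategory

/-- Hom-functors are small presheaves. -/
theorem isSmallPresheaf_yoneda {A : Type u} [Category.{w} A] (X : A) :
    isSmallPresheaf A (yoneda.obj X) :=
  let p := IndObjectPresentation.yoneda X
  ⟨p.I, p.ℐ, p.F, p.ι, ⟨p.isColimit⟩⟩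

/-- The Yoneda embedding of `A` into the category of small presheaves. -/
def smallYoneda (A : Type u) [Category.{w} A] : A ⥤ SmallPresheaf A :=
  (isSmallPresheaf A).lift yoneda isSmallPresheaf_yoneda

/-- The small presheaves which are colimits, in the category of small presheaves, of hom-functors
along a small `κ`-filtered diagram. -/
def isInd (A : Type u) [Category.{w} A] (κ : Cardinal.{w}) [Fact κ.IsRegular] :
    ObjectProperty (SmallPresheaf A) :=
  fun P => ∃ (J : Type w) (_ : SmallCategory J) (_ : IsCardinalFiltered J κ) (F : J ⥤ A)
    (ι : F ⋙ smallYoneda A ⟶ (Functor.const J).obj P), Nonempty (IsColimit (Cocone.mk P ι))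

/-- The category `Ind_κ(A)`, a full subcategory of the category of small presheaves on `A`. -/
abbrev Ind (A : Type u) [Category.{w} A] (κ : Cardinal.{w}) [Fact κ.IsRegular] :=
  (isInd A κ).FullSubcategory

end ClassAccessible

namespace ClassAccessible

/-! ### Categories of elements of small presheaves and of ind-objects -/

section Presheaves

variable {A : Type u} [Category.{w} A]

/-! Membership of `P` in `Ind_κ(A)` can be read off its category of elements: it must be
`κ`-filtered and have a small weakly terminal set. If `A` is approximately complete, the limit in
presheaves of a diagram of ind-objects inherits both properties, so it is a limit in `Ind_κ(A)`.
Filteredness passes to the limit because it makes each presheaf turn `κ`-small colimits of `A` into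
limits. For weak terminality, every element of the limit factors through a cone over one of a small
set of diagrams in `A`, to which approximate completeness applies. Conversely, elements of the limit
of the representables on `D` are cones over `D`, and this limit is a small presheaf. -/

theorem isSmallPresheaf.finallySmall {P : Aᵒᵖ ⥤ Type w} (hP : isSmallPresheaf A P) :
    FinallySmall.{w} (CostructuredArrow yoneda P) := by
  obtain ⟨J, _, F, ι, ⟨h⟩⟩ := hP
  have := Presheaf.final_toCostructuredArrow_comp_pre F h
  exact FinallySmall.mk' ((Cocone.mk P ι).toCostructuredArrow ⋙ CostructuredArrow.pre F yoneda P)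

theorem hasWeaklyTerminalSet_of_finallySmall (C : Type u) [Category.{v} C] [FinallySmall.{w} C] :
    HasWeaklyTerminalSet.{w} C := by
  obtain ⟨S, hS, h⟩ := FinallySmall.exists_small_weakly_terminal_set.{w} C
  exact ⟨S, hS, h⟩

/-- The full subcategory on the weakly terminal set works: cocones can be pushed forward into it,
which gives both finality and `κ`-filteredness. -/
theorem HasWeaklyTerminalSet.exists_final {C : Type u} [Category.{w} C] (κ : Cardinal.{w})
    [Fact κ.IsRegular] [IsCardinalFiltered C κ] (h : HasWeaklyTerminalSet.{w} C) :
    ∃ (J : Type w) (_ : SmallCategory J) (_ : IsCardinalFiltered J κ) (F : J ⥤ C), F.Final := by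
  obtain ⟨S, _, hS⟩ := h
  have := isFiltered_of_isCardinalFiltered C κ
  let Q : ObjectProperty C := (· ∈ S)
  have hQ : ∀ X, ∃ T : Q.FullSubcategory, Nonempty (X ⟶ Q.ι.obj T) := fun X ↦ by
    obtain ⟨T, hT, f⟩ := hS X
    exact ⟨⟨T, hT⟩, f⟩
  have : Q.ι.Final := Functor.final_of_exists_of_isFiltered_of_fullyFaithful _ hQ
  have : IsCardinalFiltered Q.FullSubcategory κ :=
    { nonempty_cocone := fun F hF ↦ by
        let c := IsCardinalFiltered.cocone (F ⋙ Q.ι) hF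
        obtain ⟨T, ⟨f⟩⟩ := hQ c.pt
        exact ⟨{
          pt := T
          ι := { app := fun a ↦ ObjectProperty.homMk (c.ι.app a ≫ f)
                 naturality := fun a b g ↦ by
                  ext
                  have := c.w g
                  dsimp at this ⊢
                  simp [reassoc_of% this] } }⟩ }
  have : Small.{w} Q.FullSubcategory :=
    small_of_injective (β := S) (f := fun T ↦ ⟨T.obj, T.property⟩) (fun T T' h ↦ by
      ext; exact congrArg Subtype.val h)
  let e := equivSmallModel.{w} Q.FullSubcategory
  exact ⟨SmallModel.{w} Q.FullSubcategory, inferInstance, .of_equivalence κ e,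
    e.inverse ⋙ Q.ι, inferInstance⟩

theorem isSmallPresheaf_of_final {P : Aᵒᵖ ⥤ Type w} {J : Type w} [SmallCategory J]
    (G : J ⥤ CostructuredArrow yoneda P) [G.Final] : isSmallPresheaf A P :=
  ⟨J, inferInstance, G ⋙ CostructuredArrow.proj yoneda P,
    ((Presheaf.tautologicalCocone P).whisker G).ι,
    ⟨(Functor.Final.isColimitWhiskerEquiv _ _).symm (Presheaf.isColimitTautologicalCocone P)⟩⟩

theorem isInd_of_final {P : SmallPresheaf A} (κ : Cardinal.{w}) [Fact κ.IsRegular] {J : Type w}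
    [SmallCategory J] [IsCardinalFiltered J κ] (G : J ⥤ CostructuredArrow yoneda P.obj)
    [G.Final] : isInd A κ P := by
  let F : J ⥤ A := G ⋙ CostructuredArrow.proj yoneda P.obj
  let ι : F ⋙ smallYoneda A ⟶ (Functor.const J).obj P :=
    { app := fun j ↦ ObjectProperty.homMk (G.obj j).hom
      naturality := fun i j f ↦ by
        ext1
        exact ((Presheaf.tautologicalCocone P.obj).whisker G).ι.naturality f }
  refine ⟨J, inferInstance, inferInstance, F, ι, ⟨isColimitOfReflects (isSmallPresheaf A).ι ?_⟩⟩
  exact (Functor.Final.isColimitWhiskerEquiv G _).symm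
    (Presheaf.isColimitTautologicalCocone P.obj)

/-- The presheaf colimit of the diagram is itself small, so the inclusion preserves the given
colimit. The diagram is then final in the category of elements. -/
theorem isInd.isCardinalFiltered {P : SmallPresheaf A} {κ : Cardinal.{w}} [Fact κ.IsRegular]
    (hP : isInd A κ P) : IsCardinalFiltered (CostructuredArrow yoneda P.obj) κ := by
  obtain ⟨J, _, _, F, ι, ⟨h⟩⟩ := hP
  let c : Cocone (F ⋙ yoneda) := colimit.cocone _
  have hc : IsColimit c := colimit.isColimit _
  let c' : Cocone (F ⋙ smallYoneda A) :=
    { pt := ⟨c.pt, J, inferInstance, F, c.ι, ⟨hc⟩⟩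
      ι := { app := fun j ↦ ObjectProperty.homMk (c.ι.app j)
             naturality := fun i j f ↦ by
              ext1
              exact c.ι.naturality f } }
  have hc' : IsColimit c' := isColimitOfReflects (isSmallPresheaf A).ι hc
  have : PreservesColimit (F ⋙ smallYoneda A) (isSmallPresheaf A).ι :=
    preservesColimit_of_preserves_colimit_cocone hc' hc
  let d : Cocone (F ⋙ yoneda) := (isSmallPresheaf A).ι.mapCocone (Cocone.mk P ι)
  have hd : IsColimit d := isColimitOfPreserves (isSmallPresheaf A).ι h
  have := Presheaf.final_toCostructuredArrow_comp_pre F hd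
  exact .of_final (d.toCostructuredArrow ⋙ CostructuredArrow.pre F yoneda d.pt) κ

theorem isInd_smallYoneda (κ : Cardinal.{w}) [Fact κ.IsRegular] (X : A) :
    isInd A κ ((smallYoneda A).obj X) := by
  have : IsCardinalFiltered (Discrete PUnit.{w + 1}) κ := isCardinalFiltered_of_hasTerminal _ κ
  exact ⟨Discrete PUnit.{w + 1}, inferInstance, inferInstance, Functor.fromPUnit X,
    { app := fun _ ↦ 𝟙 _ },
    ⟨{ desc := fun s ↦ s.ι.app ⟨PUnit.unit⟩
       uniq := fun s m h ↦ by simpa using h ⟨PUnit.unit⟩ }⟩⟩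

/-- If the category of elements of `P` is `κ`-filtered, then `P` sends `κ`-small colimits
to limits. -/
theorem existsUnique_yoneda_desc {P : Aᵒᵖ ⥤ Type w} {κ : Cardinal.{w}} [Fact κ.IsRegular]
    [IsCardinalFiltered (CostructuredArrow yoneda P) κ] {K : Type w} [SmallCategory K]
    (hK : HasCardinalLT (Arrow K) κ) {D : K ⥤ A} {c : Cocone D} (hc : IsColimit c)
    (s : ∀ k, yoneda.obj (D.obj k) ⟶ P)
    (hs : ∀ {k l : K} (f : k ⟶ l), yoneda.map (D.map f) ≫ s l = s k) :
    ∃! f : yoneda.obj c.pt ⟶ P, ∀ k, yoneda.map (c.ι.app k) ≫ f = s k := by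
  have := isFiltered_of_isCardinalFiltered (CostructuredArrow yoneda P) κ
  refine existsUnique_of_exists_of_unique ?_ ?_
  · let E : K ⥤ CostructuredArrow yoneda P :=
      { obj := fun k ↦ CostructuredArrow.mk (s k)
        map := fun f ↦ CostructuredArrow.homMk (D.map f) (by simpa using hs f) }
    let d := IsCardinalFiltered.cocone E hK
    let e : Cocone D := (CostructuredArrow.proj yoneda P).mapCocone d
    let x : yoneda.obj e.pt ⟶ P := d.pt.hom
    have he k : yoneda.map (e.ι.app k) ≫ x = s k := CostructuredArrow.w (d.ι.app k)
    exact ⟨yoneda.map (hc.desc e) ≫ x, fun k ↦ by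
      rw [← he, ← hc.fac e k, yoneda.map_comp, Category.assoc]⟩
  · intro f g hf hg
    let X := CostructuredArrow.mk f
    let Y := CostructuredArrow.mk g
    let Z := IsFiltered.max X Y
    let a : X ⟶ Z := IsFiltered.leftToMax X Y
    let b : Y ⟶ Z := IsFiltered.rightToMax X Y
    let a' (k : K) : CostructuredArrow.mk (s k) ⟶ Z :=
      (CostructuredArrow.homMk (c.ι.app k) (hf k) : _ ⟶ X) ≫ a
    let b' (k : K) : CostructuredArrow.mk (s k) ⟶ Z :=
      (CostructuredArrow.homMk (c.ι.app k) (hg k) : _ ⟶ Y) ≫ b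
    -- One map out of `Z` equalizes all the pairs at once, so `f` and `g` are restrictions of the
    -- same element of `P`.
    obtain ⟨W, q, hq⟩ := IsCardinalFiltered.multicoequalizer a' b'
      (hasCardinalLT_of_hasCardinalLT_arrow hK)
    have h : (a ≫ q).left = (b ≫ q).left := hc.hom_ext fun k ↦ by
      simpa [a', b'] using congrArg CommaMorphism.left (hq k)
    have h₁ := CostructuredArrow.w (a ≫ q)
    have h₂ := CostructuredArrow.w (b ≫ q)
    rw [h] at h₁
    exact h₁.symm.trans h₂

/-! ### Elements of limits of presheaves -/

variable {J : Type w} [SmallCategory J] {G : J ⥤ Aᵒᵖ ⥤ Type w} {c : Cone G}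

theorem isCardinalFiltered_of_isLimit {κ : Cardinal.{w}} [Fact κ.IsRegular]
    (hA : CardinalCocomplete A κ) (hc : IsLimit c)
    (hG : ∀ j, IsCardinalFiltered (CostructuredArrow yoneda (G.obj j)) κ) :
    IsCardinalFiltered (CostructuredArrow yoneda c.pt) κ where
  nonempty_cocone {K _} E hK := by
    have := hA K hK
    let D : K ⥤ A := E ⋙ CostructuredArrow.proj yoneda c.pt
    let x (k : K) : yoneda.obj (D.obj k) ⟶ c.pt := (E.obj k).hom
    have hx {k l : K} (f : k ⟶ l) : yoneda.map (D.map f) ≫ x l = x k :=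
      CostructuredArrow.w (E.map f)
    choose f hf hf' using fun j ↦ existsUnique_yoneda_desc hK (colimit.isColimit D)
      (fun k ↦ x k ≫ c.π.app j) (fun f ↦ by rw [reassoc_of% (hx f)])
    dsimp at f hf hf'
    -- The extensions over `colimit D` are unique, hence compatible with the transition maps of `G`.
    let t : Cone G :=
      { pt := yoneda.obj (colimit D)
        π := { app := f
               naturality := fun i j g ↦ by
                dsimp
                rw [Category.id_comp]
                refine (hf' j _ fun k ↦ ?_).symm
                rw [reassoc_of% (hf i k), c.w] } }
    let y : yoneda.obj (colimit D) ⟶ c.pt := hc.lift t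
    have hy k : yoneda.map (colimit.ι D k) ≫ y = x k := hc.hom_ext fun j ↦ by
      rw [Category.assoc, ← hf]
      exact congrArg _ (hc.fac t j)
    exact ⟨{
      pt := CostructuredArrow.mk y
      ι := { app := fun k ↦ CostructuredArrow.homMk (colimit.ι D k) (hy k)
             naturality := fun k l g ↦ by
              ext
              exact (colimit.w D g).trans (Category.comp_id _).symm } }⟩

variable (G) in
/-- A choice of elements `obj j` of the presheaves `G.obj j`, together with cospans witnessing that
these elements are compatible up to a zigzag of length two. -/
structure CompatibleElements where
  /-- The chosen elements. -/
  obj (j : J) : CostructuredArrow yoneda (G.obj j)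
  /-- The tips of the cospans. -/
  tip (r : Arrow J) : CostructuredArrow yoneda (G.obj r.right)
  /-- The legs on the side of the source. -/
  fst (r : Arrow J) : (CostructuredArrow.map (G.map r.hom)).obj (obj r.left) ⟶ tip r
  /-- The legs on the side of the target. -/
  snd (r : Arrow J) : obj r.right ⟶ tip r

namespace CompatibleElements

variable (d : CompatibleElements G)

/-- The diagram in `A` underlying a compatible family of elements. -/
abbrev index : MulticospanIndex.{w, w} ⟨J, Arrow J, fun r ↦ r.left, fun r ↦ r.right⟩ A where
  left j := (d.obj j).left
  right r := (d.tip r).left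
  fst r := (d.fst r).left
  snd r := (d.snd r).left

/-- A cone over the diagram underlying a compatible family of elements gives a cone over `G`. -/
def cone {X : A} (a : ∀ j, X ⟶ (d.obj j).left)
    (h : ∀ r : Arrow J, a r.left ≫ (d.fst r).left = a r.right ≫ (d.snd r).left) : Cone G where
  pt := yoneda.obj X
  π :=
    { app := fun j ↦ yoneda.map (a j) ≫ (d.obj j).hom
      naturality := fun i j f ↦ by
        have h₁ := CostructuredArrow.w (d.fst (Arrow.mk f))
        have h₂ := CostructuredArrow.w (d.snd (Arrow.mk f))
        have h₃ : a i ≫ (d.fst (Arrow.mk f)).left = a j ≫ (d.snd (Arrow.mk f)).left :=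
          h (Arrow.mk f)
        dsimp at h₁ h₂ ⊢
        rw [Category.id_comp, Category.assoc, ← h₁, ← h₂, ← yoneda.map_comp_assoc,
          ← yoneda.map_comp_assoc, h₃] }

theorem small (S : ∀ j, Set (CostructuredArrow yoneda (G.obj j))) [∀ j, Small.{w} (S j)] :
    Small.{w} {d : CompatibleElements G // (∀ j, d.obj j ∈ S j) ∧ ∀ r, d.tip r ∈ S r.right} :=
  small_of_surjective (α := Σ (s : ∀ j, S j) (t : ∀ r : Arrow J, S r.right),
    (∀ r : Arrow J, (CostructuredArrow.map (G.map r.hom)).obj (s r.left).1 ⟶ (t r).1) ×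
      (∀ r : Arrow J, (s r.right).1 ⟶ (t r).1))
    (f := fun x ↦ ⟨⟨fun j ↦ x.1 j, fun r ↦ x.2.1 r, x.2.2.1, x.2.2.2⟩,
      fun j ↦ (x.1 j).2, fun r ↦ (x.2.1 r).2⟩)
    fun ⟨d, h₁, h₂⟩ ↦
      ⟨⟨fun j ↦ ⟨d.obj j, h₁ j⟩, fun r ↦ ⟨d.tip r, h₂ r⟩, d.fst, d.snd⟩, rfl⟩

/-- If the categories of elements are filtered, every element of a cone over `G` factors through a
compatible family of elements chosen in given weakly terminal sets. -/
theorem exists_factorization (c : Cone G)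
    [∀ j, IsFiltered (CostructuredArrow yoneda (G.obj j))]
    {S : ∀ j, Set (CostructuredArrow yoneda (G.obj j))}
    (hS : ∀ j X, ∃ T ∈ S j, Nonempty (X ⟶ T)) {X : A} (x : yoneda.obj X ⟶ c.pt) :
    ∃ (d : CompatibleElements G) (a : ∀ j, X ⟶ (d.obj j).left),
      (∀ j, d.obj j ∈ S j) ∧ (∀ r, d.tip r ∈ S r.right) ∧
        (∀ r : Arrow J, a r.left ≫ (d.fst r).left = a r.right ≫ (d.snd r).left) ∧
        ∀ j, yoneda.map (a j) ≫ (d.obj j).hom = x ≫ c.π.app j := by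
  choose s hs a using fun j ↦ hS j (CostructuredArrow.mk (x ≫ c.π.app j))
  replace a j := (a j).some
  have ha j : yoneda.map (a j).left ≫ (s j).hom = x ≫ c.π.app j :=
    CostructuredArrow.w (a j)
  have H (r : Arrow J) : ∃ (t : CostructuredArrow yoneda (G.obj r.right)) (_ : t ∈ S r.right)
      (p : (CostructuredArrow.map (G.map r.hom)).obj (s r.left) ⟶ t) (q : s r.right ⟶ t),
      (a r.left).left ≫ p.left = (a r.right).left ≫ q.left := by
    let e : CostructuredArrow.mk (x ≫ c.π.app r.right) ⟶
        (CostructuredArrow.map (G.map r.hom)).obj (s r.left) :=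
      CostructuredArrow.homMk (a r.left).left (by
        change yoneda.map (a r.left).left ≫ (s r.left).hom ≫ G.map r.hom = x ≫ c.π.app r.right
        rw [reassoc_of% (ha r.left), c.w])
    obtain ⟨t₀, p, q, h⟩ := IsFiltered.span e (a r.right)
    obtain ⟨t, ht, ⟨g⟩⟩ := hS _ t₀
    refine ⟨t, ht, p ≫ g, q ≫ g, ?_⟩
    simpa [e] using congrArg (fun z ↦ z.left ≫ g.left) h
  choose t ht p q hpq using H
  exact ⟨⟨s, t, p, q⟩, fun j ↦ (a j).left, hs, ht, hpq, ha⟩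

end CompatibleElements

/-- With vertices and tips confined to weakly terminal sets, only a small set of compatible families
occurs. Each is a small diagram in `A`, and its weakly terminal cones induce the required elements
of the limit. -/
theorem hasWeaklyTerminalSet_of_isLimit (hA : ApproximatelyComplete.{w} A) (hc : IsLimit c)
    [∀ j, IsFiltered (CostructuredArrow yoneda (G.obj j))]
    (hG : ∀ j, HasWeaklyTerminalSet.{w} (CostructuredArrow yoneda (G.obj j))) :
    HasWeaklyTerminalSet.{w} (CostructuredArrow yoneda c.pt) := by
  choose S _ hS using hG
  choose T _ hT using fun d : CompatibleElements G ↦ hA _ d.index.multicospan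
  have := CompatibleElements.small S
  let lift (d : CompatibleElements G) (m : Multifork d.index) : yoneda.obj m.pt ⟶ c.pt :=
    hc.lift (d.cone m.ι m.condition)
  have lift_π d m j : lift d m ≫ c.π.app j = yoneda.map (m.ι j) ≫ (d.obj j).hom := hc.fac _ j
  refine ⟨Set.range fun x : Σ d : {d : CompatibleElements G // (∀ j, d.obj j ∈ S j) ∧
      ∀ r, d.tip r ∈ S r.right}, T d.1 ↦ CostructuredArrow.mk (lift x.1.1 x.2.1),
    inferInstance, fun X ↦ ?_⟩
  obtain ⟨d, a, h₁, h₂, h, ha⟩ := CompatibleElements.exists_factorization c hS X.hom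
  obtain ⟨m, hm, ⟨f⟩⟩ := hT d (Multifork.ofι d.index X.left a h)
  let g : X.left ⟶ m.pt := f.hom
  let b (j : J) : m.pt ⟶ (d.obj j).left := Multifork.ι m j
  have hg j : g ≫ b j = a j := f.w (WalkingMulticospan.left j)
  have hb j : lift d m ≫ c.π.app j = yoneda.map (b j) ≫ (d.obj j).hom := lift_π d m j
  refine ⟨_, ⟨⟨⟨d, h₁, h₂⟩, ⟨m, hm⟩⟩, rfl⟩, ⟨CostructuredArrow.homMk g ?_⟩⟩
  change yoneda.map g ≫ lift d m = X.hom
  exact hc.hom_ext fun j ↦ by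
    rw [← ha, ← hg, yoneda.map_comp, Category.assoc, Category.assoc, hb]

end Presheaves

/-! ### Limits in `Ind_κ(A)` -/

section Ind

variable {A : Type u} [Category.{w} A] (κ : Cardinal.{w}) [Fact κ.IsRegular]

/-- The inclusion of `Ind_κ(A)` into the category of presheaves on `A`. -/
abbrev indInclusion : Ind A κ ⥤ Aᵒᵖ ⥤ Type w :=
  (isInd A κ).ι ⋙ (isSmallPresheaf A).ι

/-- The Yoneda embedding of `A` into `Ind_κ(A)`. -/
def indYoneda : A ⥤ Ind A κ :=
  (isInd A κ).lift (smallYoneda A) (isInd_smallYoneda κ)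

theorem hasLimitsOfSize_ind (hA : CardinalCocomplete A κ) (hA' : ApproximatelyComplete.{w} A) :
    HasLimitsOfSize.{w, w} (Ind A κ) where
  has_limits_of_shape J _ :=
    { has_limit := fun G ↦ by
        let H := G ⋙ indInclusion κ
        have hH j : IsCardinalFiltered (CostructuredArrow yoneda (H.obj j)) κ :=
          (G.obj j).property.isCardinalFiltered
        have hc := limit.isLimit H
        have : IsCardinalFiltered (CostructuredArrow yoneda (limit H)) κ :=
          isCardinalFiltered_of_isLimit hA hc hH
        have hH' j : IsFiltered (CostructuredArrow yoneda (H.obj j)) :=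
          isFiltered_of_isCardinalFiltered _ κ
        have hw : HasWeaklyTerminalSet.{w} (CostructuredArrow yoneda (limit H)) :=
          hasWeaklyTerminalSet_of_isLimit hA' hc fun j ↦
            have := (G.obj j).obj.property.finallySmall
            hasWeaklyTerminalSet_of_finallySmall (CostructuredArrow yoneda (G.obj j).obj.obj)
        obtain ⟨K, _, _, F, _⟩ := hw.exists_final κ
        have : CreatesLimit G (indInclusion κ) :=
          createsLimitOfFullyFaithfulOfIso
            ⟨⟨limit H, isSmallPresheaf_of_final F⟩, isInd_of_final κ F⟩ (Iso.refl _)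
        exact hasLimit_of_created G (indInclusion κ) }

theorem approximatelyComplete_of_hasLimitsOfSize_ind [HasLimitsOfSize.{w, w} (Ind A κ)] :
    ApproximatelyComplete.{w} A := by
  intro J _ D
  let L := limit (D ⋙ indYoneda κ)
  have := L.obj.property.finallySmall
  obtain ⟨S, _, hS⟩ := hasWeaklyTerminalSet_of_finallySmall.{w}
    (CostructuredArrow yoneda L.obj.obj)
  let π (j : J) : L.obj.obj ⟶ yoneda.obj (D.obj j) :=
    (indInclusion κ).map (limit.π (D ⋙ indYoneda κ) j)
  have hπ {i j : J} (f : i ⟶ j) : π i ≫ yoneda.map (D.map f) = π j :=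
    congrArg (indInclusion κ).map (limit.w (D ⋙ indYoneda κ) f)
  -- By Yoneda, an element of `L` at `X.left` is a cone over `D` with that vertex.
  let cone (X : CostructuredArrow yoneda L.obj.obj) : Cone D :=
    { pt := X.left
      π := { app := fun j ↦ Yoneda.fullyFaithful.preimage (X.hom ≫ π j)
             naturality := fun i j f ↦ Yoneda.fullyFaithful.map_injective (by simp [hπ]) } }
  refine ⟨Set.range fun X : S ↦ cone X.1, inferInstance, fun K ↦ ?_⟩
  let t : Cone (D ⋙ indYoneda κ) := (indYoneda κ).mapCone K
  let l : yoneda.obj K.pt ⟶ L.obj.obj := (indInclusion κ).map (limit.lift _ t)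
  have hl j : l ≫ π j = yoneda.map (K.π.app j) :=
    congrArg (indInclusion κ).map (limit.lift_π t j)
  obtain ⟨X, hX, ⟨f⟩⟩ := hS (CostructuredArrow.mk l)
  refine ⟨_, ⟨⟨X, hX⟩, rfl⟩, ⟨{ hom := f.left, w := fun j ↦ ?_ }⟩⟩
  apply Yoneda.fullyFaithful.map_injective
  have h := CostructuredArrow.w f
  dsimp at h
  simp [cone, reassoc_of% h, hl]

end Ind

end ClassAccessible

theorem theorem2p4 {A : Type u} [Category.{w} A] (κ : Cardinal.{w}) [Fact κ.IsRegular]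
    (hA : ClassAccessible.CardinalCocomplete A κ) :
    HasLimitsOfSize.{w, w} (ClassAccessible.Ind A κ) ↔
      ClassAccessible.ApproximatelyComplete.{w} A :=
  ⟨fun _ ↦ ClassAccessible.approximatelyComplete_of_hasLimitsOfSize_ind κ,
    fun h ↦ ClassAccessible.hasLimitsOfSize_ind κ hA h⟩
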